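/- Let $L$ be a finite-dimensional Lie algebra over a field $F$, let $N$ be its nilradical (the largest nilpotent ideal of $L$), let $Z(N)$ be the centre of $N$, and let $C=C_L(N)=\{x\in L:[x,N]=0\}$. For a finite-dimensional Lie algebra $U$ over $F$, let $\phi(U)$ denote its Frattini ideal, the largest ideal of $U$ contained in every maximal subalgebra of $U$. Call $U$ regular if $F$ has characteristic $0$, or if $F$ has characteristic $p>0$ and either the nilradical of $U$ has nilpotency class less than $p-1$ or the solvable radical of $U$ has derived length less than $\log_2 p$. A Lie algebra is semisimple if its solvable radical is zero; the zero algebra is semisimple. For subspaces, $\dot{+}$ denotes a direct sum of vector spaces; $\oplus$ denotes a direct sum of Lie algebras. Suppose that $C$ is regular. Then: (i) if $\phi(C)\cap Z(N)=0$, then $C=Z(N)\,\dot{+}\,B$ for some semisimple subalgebra $B$ of $L$ such that $B^2=[B,B]$ is an ideal of $L$; (ii) if $\phi(L)\cap Z(N)=0$, then $C=Z(N)\oplus B$ for some ideal $B$ of $L$ that is maximal (with respect to inclusion) among the semisimple ideals of $L$; (iii) if $F$ has characteristic zero, then $L$ has a largest semisimple ideal $S$ (one that contains every semisimple ideal of $L$),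 and $C=Z(N)\oplus S$. -/

import Mathlib

namespace LieNilrad

section
variable (F L : Type*) [Field F] [LieRing L] [LieAlgebra F L]

/-- The nilradical `N(L)`: the sum of all ideals of `L` that are nilpotent as Lie algebras.
For finite-dimensional `L` it is the largest nilpotent ideal. (Mathlib's `maxNilpotentIdeal` is a
different object: it asks for nilpotency of the action of all of `L`.) -/
def nilradical : LieIdeal F L :=
  sSup {I : LieIdeal F L | LieRing.IsNilpotent I}

/-- The Frattini ideal `φ(L)`: the largest ideal of `L` contained in every maximal subalgebra. -/
def frattiniIdeal : LieIdeal F L :=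
  sSup {I : LieIdeal F L | ∀ M : LieSubalgebra F L, IsCoatom M → ∀ x ∈ I, x ∈ M}

/-- `L` is nilregular: the characteristic is zero, or it is `p > 0` and the nilpotency class of
the nilradical is less than `p - 1`. -/
def IsNilregular : Prop :=
  CharZero F ∨
    LieModule.nilpotencyLength (nilradical F L) (nilradical F L) + 1 < ringChar F

/-- `L` is solregular: the characteristic is zero, or it is `p > 0` and the derived length of the
solvable radical is less than `log₂ p`. -/
def IsSolregular : Prop :=
  CharZero F ∨
    (0 < ringChar F ∧
      (LieAlgebra.derivedLength F (LieAlgebra.radical F L) : ℝ) < Real.logb 2 (ringChar F))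

/-- `L` is regular: it is nilregular or solregular. -/
def IsRegular : Prop :=
  IsNilregular F L ∨ IsSolregular F L

end

section
variable {F L : Type*} [Field F] [LieRing L] [LieAlgebra F L]

/-- The centraliser `C_L(I) = {x ∈ L : [x, I] = 0}` of an ideal `I`; it is again an ideal. -/
def centralizer (I : LieIdeal F L) : LieIdeal F L where
  carrier := {x | ∀ y ∈ I, ⁅x, y⁆ = 0}
  zero_mem' := fun y _ => zero_lie y
  add_mem' := fun {a b} ha hb y hy => by rw [add_lie, ha y hy, hb y hy, add_zero]
  smul_mem' := fun c x hx y hy => by rw [smul_lie, hx y hy, smul_zero]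
  lie_mem := fun {z x} hx y hy => by
    rw [lie_lie, hx y hy, hx ⁅z, y⁆ (lie_mem_right F L I z y hy), lie_zero, sub_zero]

/-- The centre `Z(I)` of an ideal `I`, as an ideal of the ambient algebra. -/
def centerOf (I : LieIdeal F L) : LieIdeal F L :=
  I ⊓ centralizer I

/-- `centerOf I` consists of the elements of the centre of the Lie algebra `I`. -/
theorem mem_centerOf_iff (I : LieIdeal F L) (x : L) :
    x ∈ centerOf I ↔ ∃ h : x ∈ I, (⟨x, h⟩ : I) ∈ LieAlgebra.center F I := by
  constructor
  · rintro ⟨h, hx⟩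
    refine ⟨h, (LieModule.mem_maxTrivSubmodule _ _ _ _).2 fun y => Subtype.ext ?_⟩
    have h0 : ⁅x, (y : L)⁆ = 0 := hx y y.2
    change ⁅(y : L), x⁆ = 0
    rw [← lie_skew, h0, neg_zero]
  · rintro ⟨h, hx⟩
    refine ⟨h, fun y hy => ?_⟩
    have h0 := congrArg Subtype.val ((LieModule.mem_maxTrivSubmodule _ _ _ _).1 hx ⟨y, hy⟩)
    change ⁅y, x⁆ = 0 at h0
    rw [← lie_skew, h0, neg_zero]

/-- The Frattini ideal `φ(I)` of the Lie algebra `I`, as a subspace of the ambient algebra. -/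
def frattiniOf (I : LieIdeal F L) : Submodule F L :=
  (frattiniIdeal F I).toSubmodule.map I.toSubmodule.subtype

/-- The square `B² = [B, B]` of a subalgebra: the span of all brackets of elements of `B`. -/
def square (B : LieSubalgebra F L) : Submodule F L :=
  Submodule.span F {z | ∃ x ∈ B, ∃ y ∈ B, ⁅x, y⁆ = z}

/-- `C = A ∔ B`, a direct sum of vector spaces. -/
def IsVectorDirectSum (C A B : Submodule F L) : Prop :=
  A ⊓ B = ⊥ ∧ A ⊔ B = C

/-- `C = A ⊕ B`, a direct sum of Lie algebras, for ideals `A` and `B`. -/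
def IsAlgebraDirectSum (C A B : LieIdeal F L) : Prop :=
  IsVectorDirectSum C.toSubmodule A.toSubmodule B.toSubmodule ∧
    ∀ a ∈ A, ∀ b ∈ B, ⁅a, b⁆ = 0

/-- An ideal is semisimple if, as a Lie algebra, its solvable radical is zero. This is the usual
meaning over fields of arbitrary characteristic. -/
def IsSemisimpleIdeal (I : LieIdeal F L) : Prop :=
  LieAlgebra.HasTrivialRadical F I

end

end LieNilrad

namespace LieNilrad

/-! ### Nilpotent ideals and the nilradical -/

section NilpotentIdeals

variable {F K : Type*} [Field F] [LieRing K] [LieAlgebra F K]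

/-! Everything rests on rad(C) ⊆ Z(N) (`mem_nilradical_of_mem_radical_centralizer`). Regularity
makes the nilradical or the radical of C stable under all derivations of C, in particular under ad
L, so it is an ideal of L. In the first case N(C) ⊆ N; then C centralises N(C), and a solvable ideal
centralising the nilradical lies in it (`le_nilradical_of_isSolvable`), so rad(C) ⊆ N(C) ⊆ N. In the
second case rad(C) is itself a solvable ideal of L centralising N, hence lies in N.

Thus Z(N) is central in C and contains rad(C), so any complement of it in C is semisimple
(`hasTrivialRadical_of_complement`). For (i) and (ii), an abelian ideal meeting the Frattini ideal
trivially has a complementary subalgebra U (`exists_isCompl_of_frattiniIdeal_disjoint`), taken in C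
for (i) and in L for (ii); in (ii) C ∩ U is an ideal because Z(N) centralises C. Semisimple ideals
meet N in zero, so they lie in C, which gives maximality.

In characteristic zero C/Z(N) is semisimple, and its central extension C splits by a Whitehead-type
argument (`eq_zero_of_mem_lie_top_top_of_central`): C = Z(N) ⊕ [C,C]. Semisimple ideals are perfect
and lie in C, so [C,C] contains them all. -/

theorem lcs_succ_le_map_incl (I : LieIdeal F K) (j : ℕ) :
    I.lcs K (j + 1) ≤ LieSubmodule.map (LieSubmodule.incl I) (I.lcs I j) := by
  induction j with
  | zero =>
    rw [LieIdeal.lcs_succ, LieIdeal.lcs_zero, LieIdeal.lcs_zero]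
    intro x hx
    exact ⟨⟨x, LieSubmodule.lie_le_left _ _ hx⟩, trivial, rfl⟩
  | succ j ih =>
    rw [LieIdeal.lcs_succ, LieIdeal.lcs_succ I I, LieSubmodule.map_bracket_eq]
    exact LieSubmodule.mono_lie_right _ ih

theorem map_incl_lcs_le (I : LieIdeal F K) (j : ℕ) :
    LieSubmodule.map (LieSubmodule.incl I) (I.lcs I j) ≤ I.lcs K j := by
  induction j with
  | zero => rw [LieIdeal.lcs_zero]; exact le_top
  | succ j ih =>
    rw [LieIdeal.lcs_succ, LieIdeal.lcs_succ, LieSubmodule.map_bracket_eq]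
    exact LieSubmodule.mono_lie_right _ ih

/-- The shift by one arises because `I.lcs K` starts at K rather than at I, and [I, K] ⊆ I. -/
theorem lcs_succ_eq_bot (I : LieIdeal F K) {j : ℕ}
    (h : LieModule.lowerCentralSeries F I I j = ⊥) : I.lcs K (j + 1) = ⊥ := by
  have h' : I.lcs I j = ⊥ := by
    rw [← LieSubmodule.toSubmodule_eq_bot, LieIdeal.coe_lcs_eq, LieSubmodule.toSubmodule_eq_bot]
    exact h
  have := lcs_succ_le_map_incl I j
  rw [h', LieSubmodule.map_bot] at this
  exact le_bot_iff.1 this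

theorem isNilpotent_of_lcs_eq_bot (I : LieIdeal F K) {j : ℕ} (h : I.lcs K j = ⊥) :
    LieRing.IsNilpotent I := by
  have h1 := map_incl_lcs_le I j
  rw [h, le_bot_iff] at h1
  have h2 : I.lcs I j = ⊥ := by
    rw [eq_bot_iff]
    intro x hx
    have : (LieSubmodule.incl I) x ∈ (⊥ : LieSubmodule F K K) := by
      rw [← h1]; exact ⟨x, hx, rfl⟩
    exact Subtype.ext this
  refine (LieModule.isNilpotent_iff F I I).2 ⟨j, ?_⟩
  have h3 : (LieModule.lowerCentralSeries F I I j).toSubmodule = ⊥ := by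
    have := LieIdeal.coe_lcs_eq I I j
    rw [h2] at this
    exact this.symm.trans (by simp)
  exact (LieSubmodule.toSubmodule_eq_bot _).1 h3

theorem isNilpotent_iff_exists_lcs_eq_bot (I : LieIdeal F K) :
    LieRing.IsNilpotent I ↔ ∃ j, I.lcs K j = ⊥ := by
  refine ⟨fun h => ?_, fun ⟨j, h⟩ => isNilpotent_of_lcs_eq_bot I h⟩
  obtain ⟨j, hj⟩ := (LieModule.isNilpotent_iff F I I).1 h
  exact ⟨j + 1, lcs_succ_eq_bot I hj⟩

theorem lcs_antitone (I : LieIdeal F K) : Antitone (I.lcs K) :=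
  antitone_nat_of_succ_le fun n => by
    rw [LieIdeal.lcs_succ]; exact LieSubmodule.lie_le_right _ _

/-- Fitting's argument: expand an n-fold bracket with entries in I + J; a term with i entries from I
and j from J lies in the i-th term for I and in the j-th for J. -/
theorem lcs_sup_le (I J : LieIdeal F K) {a b : ℕ} (ha : I.lcs K a = ⊥) (hb : J.lcs K b = ⊥) :
    (I ⊔ J).lcs K (a + b) = ⊥ := by
  have key : ∀ n, (I ⊔ J).lcs K n ≤
      ⨆ p : {p : ℕ × ℕ // p.1 + p.2 = n}, I.lcs K p.1.1 ⊓ J.lcs K p.1.2 := by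
    intro n
    induction n with
    | zero => exact le_iSup_of_le ⟨(0, 0), rfl⟩ (by simp)
    | succ n ih =>
      rw [LieIdeal.lcs_succ]
      refine (LieSubmodule.mono_lie_right _ ih).trans ?_
      rw [LieSubmodule.lie_le_iff]
      intro x hx m hm
      induction hm using LieSubmodule.iSup_induction' with
      | mem p m hm =>
        obtain ⟨⟨i, j⟩, hp⟩ := p
        obtain ⟨y, hy, z, hz, rfl⟩ := (LieSubmodule.mem_sup _ _ _).1 hx
        rw [add_lie]
        refine add_mem ?_ ?_
        · refine LieSubmodule.mem_iSup_of_mem ⟨(i + 1, j), by simp at hp ⊢; omega⟩ ⟨?_, ?_⟩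
          · change _ ∈ I.lcs K (i + 1)
            rw [LieIdeal.lcs_succ]; exact LieSubmodule.lie_mem_lie hy hm.1
          · exact LieSubmodule.lie_mem _ hm.2
        · refine LieSubmodule.mem_iSup_of_mem ⟨(i, j + 1), by simp at hp ⊢; omega⟩ ⟨?_, ?_⟩
          · exact LieSubmodule.lie_mem _ hm.1
          · change _ ∈ J.lcs K (j + 1)
            rw [LieIdeal.lcs_succ]; exact LieSubmodule.lie_mem_lie hz hm.2
      | zero => rw [lie_zero]; exact zero_mem _
      | add m m' _ _ h h' => rw [lie_add]; exact add_mem h h'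
  refine le_bot_iff.1 ((key _).trans (iSup_le ?_))
  rintro ⟨⟨i, j⟩, hp⟩
  rcases le_or_gt a i with h | h
  · exact inf_le_left.trans ((lcs_antitone I h).trans ha.le)
  · exact inf_le_right.trans ((lcs_antitone J (by dsimp only at hp ⊢; omega)).trans hb.le)

theorem isNilpotent_nilradical [FiniteDimensional F K] :
    LieRing.IsNilpotent (nilradical F K) := by
  -- By the ascending chain condition a nonempty family closed under binary suprema contains its
  -- supremum.
  have hwf := LieSubmodule.wellFoundedGT_of_noetherian F K K
  rw [← CompleteLattice.isSupClosedCompact_iff_wellFoundedGT] at hwf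
  refine hwf {I : LieIdeal F K | LieRing.IsNilpotent I} ⟨⊥, ?_⟩ fun I hI J hJ => ?_
  · exact isNilpotent_of_lcs_eq_bot (j := 1) _ (by simp)
  · obtain ⟨a, ha⟩ := (isNilpotent_iff_exists_lcs_eq_bot I).1 hI
    obtain ⟨b, hb⟩ := (isNilpotent_iff_exists_lcs_eq_bot J).1 hJ
    exact isNilpotent_of_lcs_eq_bot _ (lcs_sup_le I J ha hb)

theorem le_nilradical (I : LieIdeal F K) (h : LieRing.IsNilpotent I) : I ≤ nilradical F K :=
  le_sSup h

/-- Climb the derived series from its zero term. If [A, A] lies in the nilradical, which A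
centralises, then [A, [A, A]] = 0, so A is nilpotent and lies in the nilradical too. -/
theorem le_nilradical_of_isSolvable (I : LieIdeal F K) [hs : LieAlgebra.IsSolvable I]
    (hI : ∀ x ∈ I, ∀ y ∈ nilradical F K, ⁅x, y⁆ = 0) : I ≤ nilradical F K := by
  obtain ⟨k, hk⟩ := (LieAlgebra.isSolvable_iff F (L := I)).1 hs
  rw [LieIdeal.derivedSeries_eq_bot_iff] at hk
  have key : ∀ i j, i + j = k → LieAlgebra.derivedSeriesOfIdeal F K j I ≤ nilradical F K := by
    intro i
    induction i with
    | zero => intro j hj; obtain rfl : j = k := by omega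
              rw [hk]; exact bot_le
    | succ i ih =>
      intro j hj
      have h1 := ih (j + 1) (by omega)
      have h0 := LieAlgebra.derivedSeriesOfIdeal_le_self I j
      set A := LieAlgebra.derivedSeriesOfIdeal F K j I
      rw [LieAlgebra.derivedSeriesOfIdeal_succ] at h1
      refine le_nilradical _ (isNilpotent_of_lcs_eq_bot (j := 3) _ ?_)
      have hA : A.lcs K 1 ≤ A := by
        rw [LieIdeal.lcs_succ]; exact LieSubmodule.lie_le_left _ _
      rw [LieIdeal.lcs_succ, LieIdeal.lcs_succ, LieSubmodule.lie_eq_bot_iff]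
      intro x hx m hm
      exact hI x (h0 hx) m (h1 (LieSubmodule.mono_lie_right _ hA hm))
  exact key k 0 rfl

end NilpotentIdeals

/-! ### Leibniz rule for powers in an associative algebra -/

section NoncommutativeLeibniz

variable {F E : Type*} [Field F] [Ring E] [Algebra F E]

theorem iterate_leibniz (δ : Module.End F E) (hδ : ∀ u v, δ (u * v) = δ u * v + u * δ v)
    (n : ℕ) (a b : E) :
    (δ ^ n) (a * b) =
      ∑ ij ∈ Finset.HasAntidiagonal.antidiagonal n, n.choose ij.1 • ((δ ^ ij.1) a * (δ ^ ij.2) b) := by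
  induction n with
  | zero => simp
  | succ n ih =>
    rw [Finset.sum_antidiagonal_choose_succ_nsmul
      (M := E) (fun i j => (δ ^ i) a * (δ ^ j) b) n]
    simp only [pow_succ', Module.End.mul_apply, ih, map_sum, map_nsmul, hδ, smul_add,
      Finset.sum_add_distrib]
    rw [add_comm]
    congr 1
    refine Finset.sum_congr rfl fun x hx => ?_
    rw [Nat.choose_symm_of_eq_add (Finset.HasAntidiagonal.mem_antidiagonal.1 hx).symm]

/-- Modulo I, a product containing an undifferentiated factor a vanishes. Fewer than m derivatives
leave such a factor in every term of a^m; exactly m must hit each factor once, in m! ways. -/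
theorem derivation_pow_mem (δ : Module.End F E)
    (hδ : ∀ u v, δ (u * v) = δ u * v + u * δ v) (A : Subalgebra F E) (I : Submodule F E)
    (hAI : ∀ u ∈ A, ∀ v ∈ I, u * v ∈ I) (hIA : ∀ u ∈ I, ∀ v ∈ A, u * v ∈ I)
    {a : E} (ha : a ∈ I) (hδa : ∀ i, (δ ^ i) a ∈ A) (m : ℕ) :
    (∀ j, (δ ^ j) (a ^ m) ∈ A) ∧ (∀ j < m, (δ ^ j) (a ^ m) ∈ I) ∧
      (δ ^ m) (a ^ m) - m.factorial • (δ a) ^ m ∈ I := by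
  induction m with
  | zero =>
    refine ⟨fun j => ?_, fun j hj => absurd hj (Nat.not_lt_zero j), by simp⟩
    have h1 : δ 1 = 0 := by simpa using hδ 1 1
    rcases j with _ | j
    · simp
    · rw [pow_succ, pow_zero, Module.End.mul_apply, h1, map_zero]; exact zero_mem A
  | succ m ih =>
    obtain ⟨hA, hI, hm⟩ := ih
    refine ⟨fun j => ?_, fun j hj => ?_, ?_⟩
    · rw [pow_succ', iterate_leibniz δ hδ]
      exact sum_mem fun ij _ => nsmul_mem (mul_mem (hδa _) (hA _)) _
    · rw [pow_succ', iterate_leibniz δ hδ]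
      refine sum_mem fun ij hij => nsmul_mem ?_ _
      obtain ⟨i, k⟩ := ij
      rw [Finset.HasAntidiagonal.mem_antidiagonal] at hij
      rcases i with _ | i
      · exact hIA _ ha _ (hA _)
      · exact hAI _ (hδa _) _ (hI _ (by dsimp only at hij ⊢; omega))
    · have h1 : (m + 1) • (δ a * (δ ^ m) (a ^ m)) - (m + 1).factorial • (δ a) ^ (m + 1) ∈ I := by
        have := nsmul_mem (hAI (δ a) (by simpa using hδa 1) _ hm) (m + 1)
        rwa [mul_sub, mul_smul_comm, ← pow_succ', smul_sub, ← mul_smul, ← Nat.factorial_succ]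
          at this
      have hmem : ((1, m) : ℕ × ℕ) ∈ Finset.HasAntidiagonal.antidiagonal (m + 1) := by
        rw [Finset.HasAntidiagonal.mem_antidiagonal]; exact add_comm 1 m
      -- Only the split (1, m) survives modulo I: with no derivative on the first a that factor is
      -- in I, and with two or more the remaining power receives fewer than m.
      rw [pow_succ' a, iterate_leibniz δ hδ, ← Finset.add_sum_erase _ _ hmem, add_sub_right_comm]
      refine add_mem (by simpa using h1) (sum_mem fun ij hij => nsmul_mem ?_ _)
      obtain ⟨i, k⟩ := ij
      rw [Finset.mem_erase, Finset.HasAntidiagonal.mem_antidiagonal, Ne, Prod.mk.injEq] at hij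
      rcases i with _ | i
      · exact hIA _ ha _ (hA _)
      · exact hAI _ (hδa _) _ (hI _ (by dsimp only at hij ⊢; omega))

theorem add_pow_sub_pow_mem (A : Subalgebra F E) (I : Submodule F E)
    (hAI : ∀ u ∈ A, ∀ v ∈ I, u * v ∈ I) (hIA : ∀ u ∈ I, ∀ v ∈ A, u * v ∈ I)
    {u v : E} (hu : u ∈ I) (huA : u ∈ A) (hv : v ∈ A) (m : ℕ) :
    (u + v) ^ m - v ^ m ∈ I := by
  induction m with
  | zero => simp
  | succ m ih =>
    have : (u + v) ^ (m + 1) - v ^ (m + 1) =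
        u * (u + v) ^ m + v * ((u + v) ^ m - v ^ m) := by
      rw [pow_succ', pow_succ', mul_sub, add_mul]; abel
    rw [this]
    exact add_mem (hIA _ hu _ (pow_mem (add_mem huA hv) m)) (hAI _ hv _ ih)

end NoncommutativeLeibniz

/-! ### Derivations and the nilradical -/

section Filtration

variable {F K : Type*} [Field F] [LieRing K] [LieAlgebra F K]

/-- The endomorphisms preserving every term of a filtration. -/
def filtrationStabilizer (P : ℕ → Submodule F K) : Subalgebra F (Module.End F K) where
  carrier := {T | ∀ j, ∀ v ∈ P j, T v ∈ P j}
  mul_mem' := fun ha hb j v hv => ha j _ (hb j v hv)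
  add_mem' := fun ha hb j v hv => add_mem (ha j v hv) (hb j v hv)
  algebraMap_mem' := fun r j v hv => by
    rw [Module.algebraMap_end_apply]; exact Submodule.smul_mem _ r hv

/-- The endomorphisms mapping every term of a filtration to the next one. -/
def filtrationShift (P : ℕ → Submodule F K) : Submodule F (Module.End F K) where
  carrier := {T | ∀ j, ∀ v ∈ P j, T v ∈ P (j + 1)}
  zero_mem' := fun j _ _ => zero_mem (P (j + 1))
  add_mem' := fun ha hb j v hv => add_mem (ha j v hv) (hb j v hv)
  smul_mem' := fun c _ ha j v hv => Submodule.smul_mem _ c (ha j v hv)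

theorem pow_apply_mem_of_mem_filtrationShift {P : ℕ → Submodule F K} (h0 : P 0 = ⊤)
    {T : Module.End F K} (hT : T ∈ filtrationShift P) (j : ℕ) (v : K) : (T ^ j) v ∈ P j := by
  induction j with
  | zero => rw [h0]; trivial
  | succ j ih => rw [pow_succ']; exact hT j _ ih

/-- Since ad x shifts the series of N, (ad x)^n = 0. Applying the n-th power of the commutator with
D gives n! (ad Dx)^n ≡ 0 modulo shifting maps, so (ad Dx)^n shifts; adding ad y changes it only by a
shifting map. D itself need not preserve the filtration: only the maps ad(D^i x) must, and they do
because its terms are ideals. -/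
theorem isNilpotent_ad_add_derivation (N : LieIdeal F K) (D : LieDerivation F K K) {n : ℕ}
    (hn : N.lcs K n = ⊥) (hfac : ((n.factorial : ℕ) : F) ≠ 0) {x y : K} (hx : x ∈ N)
    (hy : y ∈ N) : IsNilpotent (LieAlgebra.ad F K (y + D x)) := by
  set P : ℕ → Submodule F K := fun j => (N.lcs K j).toSubmodule with hP
  set A := filtrationStabilizer P
  set I := filtrationShift P
  have hAI : ∀ u ∈ A, ∀ v ∈ I, u * v ∈ I := fun u hu v hv j w hw => hu (j + 1) _ (hv j w hw)
  have hIA : ∀ u ∈ I, ∀ v ∈ A, u * v ∈ I := fun u hu v hv j w hw => hu j _ (hv j w hw)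
  have hadA : ∀ z, LieAlgebra.ad F K z ∈ A := fun z j v hv => LieSubmodule.lie_mem _ hv
  have hadI : ∀ z ∈ N, LieAlgebra.ad F K z ∈ I := fun z hz j v hv => by
    change ⁅z, v⁆ ∈ N.lcs K (j + 1)
    rw [LieIdeal.lcs_succ]
    exact LieSubmodule.lie_mem_lie hz hv
  have hpow : ∀ T ∈ I, T ^ n = 0 := fun T hT => LinearMap.ext fun v => by
    have := pow_apply_mem_of_mem_filtrationShift (by simp [hP]) hT n v
    simpa [hP, hn] using this
  let d : Module.End F K := D.toLinearMap
  let δ : Module.End F (Module.End F K) := LinearMap.mulLeft F d - LinearMap.mulRight F d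
  have hδ : ∀ u v, δ (u * v) = δ u * v + u * δ v := fun u v => by
    simp only [δ, LinearMap.sub_apply, LinearMap.mulLeft_apply, LinearMap.mulRight_apply,
      sub_mul, mul_sub, mul_assoc]
    abel
  have hδad : ∀ z, δ (LieAlgebra.ad F K z) = LieAlgebra.ad F K (D z) := fun z =>
    LinearMap.ext fun w => by
      change D ⁅z, w⁆ - ⁅z, D w⁆ = ⁅D z, w⁆
      rw [LieDerivation.apply_lie_eq_add]; abel
  have hδi : ∀ i, (δ ^ i) (LieAlgebra.ad F K x) ∈ A := fun i => by
    have : (δ ^ i) (LieAlgebra.ad F K x) = LieAlgebra.ad F K (D^[i] x) := by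
      induction i with
      | zero => simp
      | succ i ih => rw [pow_succ', Module.End.mul_apply, ih, hδad, Function.iterate_succ_apply']
    rw [this]; exact hadA _
  have h1 := (derivation_pow_mem δ hδ A I hAI hIA (hadI x hx) hδi n).2.2
  rw [hpow _ (hadI x hx), map_zero, zero_sub, hδad, neg_mem_iff, ← Nat.cast_smul_eq_nsmul F,
    Submodule.smul_mem_iff _ hfac] at h1
  have h2 := add_mem (add_pow_sub_pow_mem A I hAI hIA (hadI y hy) (hadA y) (hadA (D x)) n) h1
  rw [sub_add_cancel, ← map_add] at h2
  -- The n-th power shifts the filtration, which has length n.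
  refine ⟨n * n, ?_⟩
  rw [pow_mul]
  exact hpow _ h2

theorem isNilpotent_of_forall_isNilpotent_ad [FiniteDimensional F K] (I : LieIdeal F K)
    (h : ∀ x ∈ I, IsNilpotent (LieAlgebra.ad F K x)) : LieRing.IsNilpotent I := by
  rw [LieAlgebra.isNilpotent_iff_forall (R := F)]
  intro x
  obtain ⟨n, hn⟩ := h x x.2
  refine ⟨n, LinearMap.ext fun y => Subtype.ext ?_⟩
  have key : ∀ m, (((LieAlgebra.ad F I x) ^ m) y : K) = ((LieAlgebra.ad F K x) ^ m) y := by
    intro m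
    induction m with
    | zero => rfl
    | succ m ih => rw [pow_succ', pow_succ', Module.End.mul_apply, Module.End.mul_apply, ← ih]; rfl
  rw [key, hn]; rfl

/-- The ideal `I + D(I)` for an ideal `I` and a derivation `D`. -/
def addDerivation (I : LieIdeal F K) (D : LieDerivation F K K) : LieIdeal F K where
  toSubmodule := I.toSubmodule ⊔ I.toSubmodule.map D.toLinearMap
  lie_mem := by
    intro z w hw
    obtain ⟨y, hy, _, ⟨x, hx, rfl⟩, rfl⟩ := Submodule.mem_sup.1 hw
    have h : ⁅z, y + D x⁆ = (⁅z, y⁆ - ⁅D z, x⁆) + D ⁅z, x⁆ := by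
      rw [LieDerivation.apply_lie_eq_add, lie_add]; abel
    change ⁅z, y + D x⁆ ∈ I.toSubmodule ⊔ I.toSubmodule.map D.toLinearMap
    rw [h]
    exact Submodule.add_mem_sup (sub_mem (LieSubmodule.lie_mem _ hy) (LieSubmodule.lie_mem _ hx))
      ⟨_, LieSubmodule.lie_mem _ hx, rfl⟩

theorem mem_addDerivation {I : LieIdeal F K} {D : LieDerivation F K K} {w : K} :
    w ∈ addDerivation I D ↔ ∃ y ∈ I, ∃ x ∈ I, y + D x = w := by
  change w ∈ I.toSubmodule ⊔ I.toSubmodule.map D.toLinearMap ↔ _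
  rw [Submodule.mem_sup]
  constructor
  · rintro ⟨y, hy, _, ⟨x, hx, rfl⟩, rfl⟩
    exact ⟨y, hy, x, hx, rfl⟩
  · rintro ⟨y, hy, x, hx, rfl⟩
    exact ⟨y, hy, _, ⟨x, hx, rfl⟩, rfl⟩

theorem factorial_cast_ne_zero_of_lt {n : ℕ} (h : CharZero F ∨ n < ringChar F) :
    ((n.factorial : ℕ) : F) ≠ 0 := by
  rcases h with h | h
  · exact Nat.cast_ne_zero.2 n.factorial_ne_zero
  · have hp : (ringChar F).Prime :=
      (CharP.char_is_prime_or_zero F (ringChar F)).resolve_right (by omega)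
    rw [Ne, ringChar.spec, hp.dvd_factorial]
    omega

/-- N + D(N) is an ideal of ad-nilpotent elements, hence nilpotent by Engel. The series of N in K
vanishes at class + 1, and class + 1 < p is what makes that factorial invertible. -/
theorem IsNilregular.derivation_mem_nilradical [FiniteDimensional F K] (h : IsNilregular F K)
    (D : LieDerivation F K K) {x : K} (hx : x ∈ nilradical F K) : D x ∈ nilradical F K := by
  have hnil : LieRing.IsNilpotent (nilradical F K) := isNilpotent_nilradical
  set n := LieModule.nilpotencyLength (nilradical F K) (nilradical F K) with hn
  have hlcs : (nilradical F K).lcs K (n + 1) = ⊥ := by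
    refine lcs_succ_eq_bot _ ?_
    rcases hk : n with _ | k
    · have := (LieModule.nilpotencyLength_eq_zero_iff (nilradical F K) (nilradical F K)).1
        (hn.symm.trans hk)
      exact Subsingleton.elim _ _
    · exact ((LieModule.nilpotencyLength_eq_succ_iff F (nilradical F K) (nilradical F K) k).1
        (hn.symm.trans hk)).1
  have hfac := factorial_cast_ne_zero_of_lt (F := F) (n := n + 1) h
  refine le_nilradical (addDerivation (nilradical F K) D)
    (isNilpotent_of_forall_isNilpotent_ad _ fun w hw => ?_)
    (mem_addDerivation.2 ⟨0, zero_mem _, x, hx, zero_add _⟩)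
  obtain ⟨y, hy, x, hx, rfl⟩ := mem_addDerivation.1 hw
  exact isNilpotent_ad_add_derivation _ D hlcs hfac hx hy

end Filtration

/-! ### Derivations and the solvable radical -/

section SolvableRadical

variable {F K : Type*} [Field F] [LieRing K] [LieAlgebra F K]

theorem iterate_derivation_mem_of_lt (R : LieIdeal F K) (D : LieDerivation F K K) (i : ℕ) :
    ∀ u ∈ LieAlgebra.derivedSeriesOfIdeal F K i R, ∀ j < 2 ^ i, D^[j] u ∈ R := by
  induction i with
  | zero =>
    intro u hu j hj
    obtain rfl : j = 0 := by simpa using hj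
    exact hu
  | succ i ih =>
    intro u hu j hj
    rw [LieAlgebra.derivedSeriesOfIdeal_succ, ← LieSubmodule.mem_toSubmodule,
      LieSubmodule.lieIdeal_oper_eq_linear_span'] at hu
    have hD : ∀ w, D^[j] w = ((D : K →ₗ[F] K) ^ j) w := fun w => by
      rw [Module.End.pow_apply]; rfl
    rw [hD]
    induction hu using Submodule.span_induction with
    | mem w hw =>
      obtain ⟨x, hx, y, hy, rfl⟩ := hw
      rw [← hD, LieDerivation.iterate_apply_lie]
      refine sum_mem fun ab hab => nsmul_mem ?_ _
      rw [Finset.HasAntidiagonal.mem_antidiagonal] at hab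
      -- Of fewer than 2^(i+1) derivatives, one of the two factors receives fewer than 2^i.
      rcases lt_or_ge ab.1 (2 ^ i) with h | h
      · exact lie_mem_left F K R _ _ (ih x hx _ h)
      · exact lie_mem_right F K R _ _ (ih y hy _ (by rw [pow_succ] at hj; omega))
    | zero => rw [map_zero]; exact zero_mem R
    | add x y _ _ hx hy => rw [map_add]; exact add_mem hx hy
    | smul c x _ hx => rw [map_smul]; exact R.smul_mem c hx

theorem iterate_derivation_lie_sub_mem (R : LieIdeal F K) (D : LieDerivation F K K) {i : ℕ}
    {u v : K} (hu : u ∈ LieAlgebra.derivedSeriesOfIdeal F K i R)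
    (hv : v ∈ LieAlgebra.derivedSeriesOfIdeal F K i R) :
    D^[2 ^ (i + 1)] ⁅u, v⁆ - (2 ^ (i + 1)).choose (2 ^ i) • ⁅D^[2 ^ i] u, D^[2 ^ i] v⁆ ∈ R := by
  have hmem : ((2 ^ i, 2 ^ i) : ℕ × ℕ) ∈ Finset.HasAntidiagonal.antidiagonal (2 ^ (i + 1)) := by
    rw [Finset.HasAntidiagonal.mem_antidiagonal, pow_succ]; omega
  rw [LieDerivation.iterate_apply_lie, ← Finset.add_sum_erase _ _ hmem, add_sub_cancel_left]
  refine sum_mem fun ab hab => nsmul_mem ?_ _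
  obtain ⟨a, b⟩ := ab
  rw [Finset.mem_erase, Finset.HasAntidiagonal.mem_antidiagonal, Ne, Prod.mk.injEq, pow_succ]
    at hab
  rcases lt_or_ge a (2 ^ i) with h | h
  · exact lie_mem_left F K R _ _ (iterate_derivation_mem_of_lt R D i u hu _ h)
  · exact lie_mem_right F K R _ _
      (iterate_derivation_mem_of_lt R D i v hv _ (by dsimp only at hab ⊢; omega))

/-- In D^(2^(i+1)) [u, v] only the balanced Leibniz term survives modulo R, so a bracket of two
elements D^(2^i) u, D^(2^i) v is recovered by dividing by the central binomial coefficient. -/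
theorem derivedSeriesOfIdeal_addDerivation_subset (R : LieIdeal F K) (D : LieDerivation F K K)
    (i : ℕ) (hi : 2 ^ i < ringChar F) :
    ∀ w ∈ LieAlgebra.derivedSeriesOfIdeal F K i (addDerivation R D),
      ∃ u ∈ LieAlgebra.derivedSeriesOfIdeal F K i R, w - D^[2 ^ i] u ∈ R := by
  induction i with
  | zero =>
    intro w hw
    obtain ⟨y, hy, x, hx, rfl⟩ := mem_addDerivation.1 hw
    exact ⟨x, hx, by simpa using hy⟩
  | succ i ih =>
    have ih := ih ((pow_lt_pow_right₀ one_lt_two i.lt_succ_self).trans hi)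
    have hp : (ringChar F).Prime :=
      (CharP.char_is_prime_or_zero F (ringChar F)).resolve_right (Nat.ne_zero_of_lt hi)
    -- The coefficient divides (2^(i+1))!, which is prime to p because 2^(i+1) < p.
    have hc : (((2 ^ (i + 1)).choose (2 ^ i) : ℕ) : F) ≠ 0 := by
      rw [Ne, ringChar.spec]
      intro hdvd
      have h1 : ringChar F ∣ (2 ^ (i + 1)).factorial := by
        rw [← Nat.choose_mul_factorial_mul_factorial
          (Nat.pow_le_pow_right (n := 2) two_pos i.le_succ), mul_assoc]
        exact hdvd.mul_right _
      rw [hp.dvd_factorial] at h1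
      omega
    have hlin : ∀ w, D^[2 ^ (i + 1)] w = ((D : K →ₗ[F] K) ^ (2 ^ (i + 1))) w := fun w => by
      rw [Module.End.pow_apply]; rfl
    intro w hw
    rw [LieAlgebra.derivedSeriesOfIdeal_succ, ← LieSubmodule.mem_toSubmodule,
      LieSubmodule.lieIdeal_oper_eq_linear_span'] at hw
    induction hw using Submodule.span_induction with
    | mem w hw =>
      obtain ⟨x, hx, y, hy, rfl⟩ := hw
      obtain ⟨u, hu, hxu⟩ := ih x hx
      obtain ⟨v, hv, hyv⟩ := ih y hy
      set c : F := (((2 ^ (i + 1)).choose (2 ^ i) : ℕ) : F) with hcdef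
      refine ⟨c⁻¹ • ⁅u, v⁆, ?_, ?_⟩
      · rw [LieAlgebra.derivedSeriesOfIdeal_succ]
        exact SMulMemClass.smul_mem _ (LieSubmodule.lie_mem_lie hu hv)
      · have h1 := R.smul_mem c⁻¹ (iterate_derivation_lie_sub_mem R D hu hv)
        rw [← Nat.cast_smul_eq_nsmul F, ← hcdef, smul_sub, inv_smul_smul₀ hc] at h1
        have h2 : ⁅x, y⁆ - ⁅D^[2 ^ i] u, D^[2 ^ i] v⁆ ∈ R := by
          have : ⁅x, y⁆ - ⁅D^[2 ^ i] u, D^[2 ^ i] v⁆ =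
              ⁅x - D^[2 ^ i] u, y⁆ + ⁅D^[2 ^ i] u, y - D^[2 ^ i] v⁆ := by
            rw [sub_lie, lie_sub]; abel
          rw [this]
          exact add_mem (lie_mem_left F K R _ _ hxu) (lie_mem_right F K R _ _ hyv)
        have h3 := sub_mem h2 h1
        rw [hlin, map_smul, ← hlin]
        convert h3 using 1
        abel
    | zero => exact ⟨0, zero_mem _, by rw [hlin, map_zero, sub_zero]; exact zero_mem R⟩
    | add x y _ _ hx hy =>
      obtain ⟨u, hu, hxu⟩ := hx
      obtain ⟨v, hv, hyv⟩ := hy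
      refine ⟨u + v, add_mem hu hv, ?_⟩
      have h1 := add_mem hxu hyv
      rw [hlin, hlin] at h1
      rw [hlin, map_add, add_sub_add_comm]
      exact h1
    | smul c x _ hx =>
      obtain ⟨u, hu, hxu⟩ := hx
      refine ⟨c • u, SMulMemClass.smul_mem _ hu, ?_⟩
      have h1 := R.smul_mem c hxu
      rw [hlin, smul_sub] at h1
      rw [hlin, map_smul]
      exact h1

theorem derivedSeriesOfIdeal_derivedLength (I : LieIdeal F K) [hs : LieAlgebra.IsSolvable I] :
    LieAlgebra.derivedSeriesOfIdeal F K (LieAlgebra.derivedLength F I) I = ⊥ := by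
  rw [LieAlgebra.derivedLength_eq_derivedLengthOfIdeal]
  obtain ⟨k, hk⟩ := (LieAlgebra.isSolvable_iff F (L := I)).1 hs
  rw [LieIdeal.derivedSeries_eq_bot_iff] at hk
  exact Nat.sInf_mem (s := {k | LieAlgebra.derivedSeriesOfIdeal F K k I = ⊥}) ⟨k, hk⟩

/-- With R^(k) = 0, the k-th derived term of R + D(R) falls into R, so R + D(R) is solvable with
derived length at most 2k. -/
theorem derivation_mem_radical [FiniteDimensional F K]
    (h : 2 ^ LieAlgebra.derivedLength F (LieAlgebra.radical F K) < ringChar F)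
    (D : LieDerivation F K K) {x : K} (hx : x ∈ LieAlgebra.radical F K) :
    D x ∈ LieAlgebra.radical F K := by
  set R := LieAlgebra.radical F K
  set k := LieAlgebra.derivedLength F R
  have hk : LieAlgebra.derivedSeriesOfIdeal F K k R = ⊥ := derivedSeriesOfIdeal_derivedLength R
  have h1 : LieAlgebra.derivedSeriesOfIdeal F K k (addDerivation R D) ≤ R := by
    intro w hw
    obtain ⟨u, hu, hwu⟩ := derivedSeriesOfIdeal_addDerivation_subset R D k h w hw
    rw [hk, LieSubmodule.mem_bot] at hu
    have h0 : ∀ j, D^[j] (0 : K) = 0 := fun j => Function.iterate_fixed (map_zero D) j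
    rwa [hu, h0, sub_zero] at hwu
  have h2 : LieAlgebra.derivedSeriesOfIdeal F K (k + k) (addDerivation R D) = ⊥ := by
    rw [LieAlgebra.derivedSeriesOfIdeal_add, eq_bot_iff, ← hk]
    exact LieAlgebra.derivedSeriesOfIdeal_mono h1 k
  have h3 : LieAlgebra.IsSolvable (addDerivation R D) :=
    LieAlgebra.IsSolvable.mk (R := F) ((LieIdeal.derivedSeries_eq_bot_iff _ _).2 h2)
  exact (LieAlgebra.LieIdeal.solvable_iff_le_radical F K _).1 h3
    (mem_addDerivation.2 ⟨0, zero_mem _, x, hx, zero_add _⟩)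

theorem two_pow_lt_of_lt_logb {k p : ℕ} (hp : 0 < p) (h : (k : ℝ) < Real.logb 2 p) :
    2 ^ k < p := by
  rw [Real.lt_logb_iff_rpow_lt one_lt_two (by exact_mod_cast hp), Real.rpow_natCast] at h
  exact_mod_cast h

end SolvableRadical

/-! ### From ideals of C to ideals of L: the radical of C lies in N -/

section IdealsOfIdeals

variable {F L : Type*} [Field F] [LieRing L] [LieAlgebra F L]

/-- The derivation of an ideal `C` induced by the adjoint action of an element of `L`. -/
def adRestrict (C : LieIdeal F L) (d : L) : LieDerivation F C C where
  toLinearMap := LieModule.toEnd F L C d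
  leibniz' x y := Subtype.ext (by
    change ⁅d, ⁅(x : L), (y : L)⁆⁆ = ⁅(x : L), ⁅d, (y : L)⁆⁆ - ⁅(y : L), ⁅d, (x : L)⁆⁆
    rw [leibniz_lie, ← lie_skew ⁅d, (x : L)⁆ (y : L)]; abel)

/-- An ideal of an ideal `C` that is stable under `L`, as an ideal of `L`. -/
def extendIdeal (C : LieIdeal F L) (J : LieIdeal F C)
    (h : ∀ d : L, ∀ x ∈ J, adRestrict C d x ∈ J) : LieIdeal F L where
  toSubmodule := J.toSubmodule.map C.toSubmodule.subtype
  lie_mem := by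
    rintro d _ ⟨x, hx, rfl⟩
    exact ⟨_, h d x hx, rfl⟩

variable {C : LieIdeal F L} {J : LieIdeal F C} {h : ∀ d : L, ∀ x ∈ J, adRestrict C d x ∈ J}

theorem mem_extendIdeal {x : L} : x ∈ extendIdeal C J h ↔ ∃ hx : x ∈ C, (⟨x, hx⟩ : C) ∈ J := by
  constructor
  · rintro ⟨y, hy, rfl⟩
    exact ⟨y.2, hy⟩
  · rintro ⟨hx, hJ⟩
    exact ⟨_, hJ, rfl⟩

/-- The identification of `extendIdeal C J h` with `J`. -/
def extendIdealHom (C : LieIdeal F L) (J : LieIdeal F C)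
    (h : ∀ d : L, ∀ x ∈ J, adRestrict C d x ∈ J) : extendIdeal C J h →ₗ⁅F⁆ J where
  toFun x := ⟨⟨x, (mem_extendIdeal.1 x.2).1⟩, (mem_extendIdeal.1 x.2).2⟩
  map_add' _ _ := rfl
  map_smul' _ _ := rfl
  map_lie' := rfl

theorem extendIdealHom_injective : Function.Injective (extendIdealHom C J h) := fun _ _ hxy =>
  Subtype.ext (congrArg (fun z : J => ((z : C) : L)) hxy)

theorem mem_nilradical_of_mem_radical_centralizer [FiniteDimensional F L]
    (hreg : IsRegular F (centralizer (nilradical F L))) (x : centralizer (nilradical F L))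
    (hx : x ∈ LieAlgebra.radical F (centralizer (nilradical F L))) :
    (x : L) ∈ nilradical F L := by
  revert x
  set C := centralizer (nilradical F L)
  intro x hx
  have of_nilregular : IsNilregular F C → (x : L) ∈ nilradical F L := by
    intro hn
    have key : ∀ y ∈ nilradical F C, (y : L) ∈ nilradical F L := by
      have hst : ∀ d : L, ∀ y ∈ nilradical F C, adRestrict C d y ∈ nilradical F C :=
        fun d y hy => hn.derivation_mem_nilradical _ hy
      have hnil : LieRing.IsNilpotent (nilradical F C) := isNilpotent_nilradical
      have : LieRing.IsNilpotent (extendIdeal C (nilradical F C) hst) :=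
        (extendIdealHom_injective (h := hst)).lieAlgebra_isNilpotent
      exact fun y hy => le_nilradical _ this (mem_extendIdeal.2 ⟨y.2, hy⟩)
    -- Since N(C) ⊆ N, all of C centralises N(C).
    refine key x (le_nilradical_of_isSolvable (LieAlgebra.radical F C) (fun y _ z hz => ?_) hx)
    exact Subtype.ext (y.2 z (key z hz))
  rcases hreg with hn | hs | ⟨hp, hs⟩
  · exact of_nilregular hn
  · exact of_nilregular (Or.inl hs)
  · have hst : ∀ d : L, ∀ y ∈ LieAlgebra.radical F C,
        adRestrict C d y ∈ LieAlgebra.radical F C :=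
      fun d y hy => derivation_mem_radical (two_pow_lt_of_lt_logb hp hs) _ hy
    have : LieAlgebra.IsSolvable (extendIdeal C (LieAlgebra.radical F C) hst) :=
      (extendIdealHom_injective (h := hst)).lieAlgebra_isSolvable
    refine le_nilradical_of_isSolvable (extendIdeal C (LieAlgebra.radical F C) hst)
      (fun y hy z hz => ?_) (mem_extendIdeal.2 ⟨x.2, hx⟩)
    exact (mem_extendIdeal.1 hy).1 z hz

end IdealsOfIdeals

/-! ### Complements from the Frattini ideal -/

section FrattiniComplement

variable {F K : Type*} [Field F] [LieRing K] [LieAlgebra F K]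

/-- Take a minimal subalgebra U with Z + U = K. As Z is abelian, Z ∩ U is an ideal. A maximal
subalgebra M not containing it would give U = (Z ∩ U) + (U ∩ M), so U ∩ M would be a smaller
supplement; hence Z ∩ U lies in the Frattini ideal. -/
theorem exists_isCompl_of_frattiniIdeal_disjoint [FiniteDimensional F K] (Z : LieIdeal F K)
    (hab : ∀ x ∈ Z, ∀ y ∈ Z, ⁅x, y⁆ = 0) (hZ : ∀ x ∈ frattiniIdeal F K, x ∈ Z → x = 0) :
    ∃ U : LieSubalgebra F K, Z.toSubmodule ⊓ U.toSubmodule = ⊥ ∧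
      Z.toSubmodule ⊔ U.toSubmodule = ⊤ := by
  obtain ⟨W, ⟨U, hU, rfl⟩, hmin⟩ := WellFounded.has_min
    (wellFounded_lt (α := Submodule F K))
    {W | ∃ U : LieSubalgebra F K, Z.toSubmodule ⊔ U.toSubmodule = ⊤ ∧ U.toSubmodule = W}
    ⟨_, ⊤, by simp, rfl⟩
  have hmin' : ∀ V : LieSubalgebra F K, V ≤ U → Z.toSubmodule ⊔ V.toSubmodule = ⊤ → U ≤ V := by
    intro V hVU hV
    by_contra hn
    exact hmin _ ⟨V, hV, rfl⟩ (lt_of_le_not_ge hVU hn)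
  refine ⟨U, ?_, hU⟩
  let I : LieIdeal F K :=
    { toSubmodule := Z.toSubmodule ⊓ U.toSubmodule
      lie_mem := by
        rintro k i ⟨hiZ, hiU⟩
        obtain ⟨z, hz, u, hu, rfl⟩ := Submodule.mem_sup.1 (hU.symm ▸ Submodule.mem_top : k ∈ _)
        rw [add_lie, hab z hz i hiZ, zero_add]
        exact ⟨lie_mem_right F K Z _ _ hiZ, U.lie_mem hu hiU⟩ }
  have hI : I ≤ frattiniIdeal F K := by
    refine le_sSup fun M hM i hi => ?_
    by_contra hiM
    let V : LieSubalgebra F K :=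
      { toSubmodule := I.toSubmodule ⊔ M.toSubmodule
        lie_mem' := by
          intro a b ha hb
          obtain ⟨i, hi, m, hm, rfl⟩ := Submodule.mem_sup.1 ha
          obtain ⟨j, hj, n, hn, rfl⟩ := Submodule.mem_sup.1 hb
          have : ⁅i + m, j + n⁆ = (⁅i, j + n⁆ + ⁅m, j⁆) + ⁅m, n⁆ := by
            rw [add_lie, lie_add m]; abel
          change ⁅i + m, j + n⁆ ∈ I.toSubmodule ⊔ M.toSubmodule
          rw [this]
          exact Submodule.add_mem_sup
            (add_mem (lie_mem_left F K I _ _ hi) (lie_mem_right F K I _ _ hj)) (M.lie_mem hm hn) }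
    have hMV : M < V := lt_of_le_not_ge (fun m hm => (le_sup_right : M.toSubmodule ≤ I.toSubmodule ⊔ M.toSubmodule) hm)
      fun hle => hiM (hle ((le_sup_left : I.toSubmodule ≤ I.toSubmodule ⊔ M.toSubmodule) hi))
    have hV : V = ⊤ := hM.2 _ hMV
    have hUM : U ≤ U ⊓ M := by
      refine hmin' _ inf_le_left (top_le_iff.1 (hU.symm.le.trans ?_))
      refine sup_le le_sup_left fun u hu => ?_
      obtain ⟨j, hj, m, hm, rfl⟩ := Submodule.mem_sup.1
        (show u ∈ I.toSubmodule ⊔ M.toSubmodule from (hV.symm ▸ trivial : u ∈ V))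
      refine Submodule.add_mem_sup hj.1 ⟨?_, hm⟩
      have := U.sub_mem hu hj.2
      rwa [add_sub_cancel_left] at this
    exact hiM (hUM hi.2).2
  rw [Submodule.eq_bot_iff]
  exact fun x hx => hZ x (hI hx) hx.1

end FrattiniComplement

/-! ### Semisimplicity of complements, and semisimple ideals against N -/

section SemisimpleIdeals

variable {F L : Type*} [Field F] [LieRing L] [LieAlgebra F L]

/-- For an abelian ideal J of B, Z + f(J) is an abelian ideal of C, hence lies in rad(C) ⊆ Z, which
forces J = 0. Using a map f covers subalgebras and ideals alike. -/
theorem hasTrivialRadical_of_complement [FiniteDimensional F L] {C Z : LieIdeal F L}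
    (hZC : Z ≤ C) (hZ : ∀ c ∈ C, ∀ z ∈ Z, ⁅c, z⁆ = 0)
    (hrad : ∀ x ∈ LieAlgebra.radical F C, (x : L) ∈ Z)
    {B : Type*} [LieRing B] [LieAlgebra F B] (f : B →ₗ⁅F⁆ L) (hf : ∀ b, f b ∈ C)
    (hfZ : ∀ b, f b ∈ Z → b = 0) (hsup : ∀ c ∈ C, ∃ z ∈ Z, ∃ b, z + f b = c) :
    LieAlgebra.HasTrivialRadical F B := by
  rw [LieAlgebra.hasTrivialRadical_iff_no_abelian_ideals]
  intro J hJ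
  have hZ' : ∀ z ∈ Z, ∀ c ∈ C, ⁅z, c⁆ = 0 := fun z hz c hc => by
    rw [← lie_skew, hZ c hc z hz, neg_zero]
  let J' : LieIdeal F C :=
    { carrier := {c | ∃ z ∈ Z, ∃ j ∈ J, z + f j = c}
      zero_mem' := ⟨0, zero_mem _, 0, zero_mem _, by simp⟩
      add_mem' := by
        rintro a b ⟨z, hz, j, hj, h1⟩ ⟨z', hz', j', hj', h2⟩
        refine ⟨z + z', add_mem hz hz', j + j', add_mem hj hj', ?_⟩
        change _ = (a : L) + b
        rw [← h1, ← h2, map_add]; abel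
      smul_mem' := by
        rintro c a ⟨z, hz, j, hj, h1⟩
        refine ⟨c • z, Z.smul_mem c hz, c • j, J.smul_mem c hj, ?_⟩
        change _ = c • (a : L)
        rw [← h1, map_smul, smul_add]
      lie_mem := by
        rintro c a ⟨z, hz, j, hj, h1⟩
        obtain ⟨z', hz', b, h2⟩ := hsup c c.2
        refine ⟨0, zero_mem _, ⁅b, j⁆, lie_mem_right F B J _ _ hj, ?_⟩
        change _ = ⁅(c : L), (a : L)⁆
        rw [← h1, ← h2, add_lie, lie_add, lie_add, hZ' z' hz' z (hZC hz), hZ' z' hz' _ (hf j),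
          hZ _ (hf b) z hz, LieHom.map_lie]
        simp }
  have hab : IsLieAbelian J' := ⟨by
    rintro ⟨a, z, hz, j, hj, h1⟩ ⟨a', z', hz', j', hj', h2⟩
    refine Subtype.ext (Subtype.ext ?_)
    change ⁅(a : L), (a' : L)⁆ = 0
    have hjj : ⁅j, j'⁆ = 0 := congrArg Subtype.val (hJ.trivial ⟨j, hj⟩ ⟨j', hj'⟩)
    rw [← h1, ← h2, add_lie, lie_add, lie_add, hZ' z hz z' (hZC hz'), hZ' z hz _ (hf j'),
      hZ _ (hf j) z' hz', ← LieHom.map_lie, hjj]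
    simp⟩
  have hle : J' ≤ LieAlgebra.radical F C :=
    (LieAlgebra.LieIdeal.solvable_iff_le_radical F C J').1 inferInstance
  rw [LieSubmodule.eq_bot_iff]
  intro j hj
  refine hfZ j (hrad ⟨f j, hf j⟩ (hle ⟨0, zero_mem _, j, hj, by simp⟩))

theorem IsSemisimpleIdeal.inf_nilradical_eq_zero [FiniteDimensional F L] {S : LieIdeal F L}
    (hS : IsSemisimpleIdeal S) {x : L} (hxS : x ∈ S) (hxN : x ∈ nilradical F L) : x = 0 := by
  have hnil : LieRing.IsNilpotent (nilradical F L) := isNilpotent_nilradical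
  let J : LieIdeal F S := LieIdeal.comap S.incl (nilradical F L)
  let g : J →ₗ⁅F⁆ nilradical F L :=
    { toFun := fun y => ⟨y.1.1, LieIdeal.mem_comap.1 y.2⟩
      map_add' := fun _ _ => rfl
      map_smul' := fun _ _ => rfl
      map_lie' := rfl }
  have hg : Function.Injective g := fun a b hab =>
    Subtype.ext (Subtype.ext (congrArg (fun z : nilradical F L => (z : L)) hab))
  have : LieAlgebra.IsSolvable J := hg.lieAlgebra_isSolvable
  have hbot := (LieAlgebra.hasTrivialRadical_iff_no_solvable_ideals F S).1 hS J this
  have : (⟨x, hxS⟩ : S) ∈ J := LieIdeal.mem_comap.2 hxN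
  rw [hbot, LieSubmodule.mem_bot] at this
  exact congrArg Subtype.val this

/-- [S, N] ⊆ S ∩ N = 0. -/
theorem IsSemisimpleIdeal.le_centralizer_nilradical [FiniteDimensional F L] {S : LieIdeal F L}
    (hS : IsSemisimpleIdeal S) : S ≤ centralizer (nilradical F L) := fun x hx y hy =>
  hS.inf_nilradical_eq_zero (lie_mem_left F L S x y hx) (lie_mem_right F L _ x y hy)

end SemisimpleIdeals

/-! ### Splitting central extensions of semisimple algebras -/

section CharZero

variable {F K S : Type*} [Field F] [LieRing K] [LieAlgebra F K] [LieRing S] [LieAlgebra F S]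

/-- The Killing complement of [S, S] is an abelian ideal, hence zero. -/
theorem lie_top_top_eq_top_of_isKilling [FiniteDimensional F S] [LieAlgebra.IsKilling F S] :
    ⁅(⊤ : LieIdeal F S), (⊤ : LieIdeal F S)⁆ = ⊤ := by
  have hc := LieIdeal.isCompl_killingCompl ⁅(⊤ : LieIdeal F S), (⊤ : LieIdeal F S)⁆
  set I := ⁅(⊤ : LieIdeal F S), (⊤ : LieIdeal F S)⁆
  have hab : IsLieAbelian (LieIdeal.killingCompl F S I) := ⟨fun x y => Subtype.ext <| by
    have h : ⁅(x : S), (y : S)⁆ ∈ I ⊓ LieIdeal.killingCompl F S I :=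
      ⟨LieSubmodule.lie_mem_lie trivial trivial, lie_mem_right F S _ _ _ y.2⟩
    rw [hc.inf_eq_bot] at h
    exact h⟩
  have hbot := LieAlgebra.IsKilling.ideal_eq_bot_of_isLieAbelian (LieIdeal.killingCompl F S I)
  have := hc.sup_eq_top
  rwa [hbot, sup_bot_eq] at this

/-- The vanishing of H²(S, F), made explicit. A functional l and a linear section s give the
2-cocycle l[sx, sy]; the Killing form turns it into a derivation, which is inner, say ad a. Then l =
κ(a, π ·) on [K, K], so every l kills [K, K] ∩ ker π. -/
theorem eq_zero_of_mem_lie_top_top_of_central [FiniteDimensional F S]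
    [LieAlgebra.IsKilling F S] (π : K →ₗ⁅F⁆ S) (hπ : Function.Surjective π)
    (hcen : ∀ c, π c = 0 → ∀ d : K, ⁅c, d⁆ = 0) {w : K}
    (hw : w ∈ ⁅(⊤ : LieIdeal F K), (⊤ : LieIdeal F K)⁆) (hw0 : π w = 0) : w = 0 := by
  refine (Module.forall_dual_apply_eq_zero_iff F w).1 fun l => ?_
  obtain ⟨s, hs⟩ := (π : K →ₗ[F] S).exists_rightInverse_of_surjective
    (LinearMap.range_eq_top.2 hπ)
  have hs' : ∀ x, π (s x) = x := fun x => LinearMap.congr_fun hs x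
  have hcong : ∀ c d e : K, π c = π d → ⁅c, e⁆ = ⁅d, e⁆ := fun c d e h => by
    rw [← sub_eq_zero, ← sub_lie]
    exact hcen _ (by rw [map_sub, h, sub_self]) e
  have hcong' : ∀ c d e : K, π c = π d → ⁅e, c⁆ = ⁅e, d⁆ := fun c d e h => by
    rw [← lie_skew, hcong c d e h, lie_skew]
  let f : S →ₗ[F] S →ₗ[F] F := LinearMap.mk₂ F (fun x y => l ⁅s x, s y⁆)
    (fun x y z => by simp) (fun c x y => by simp) (fun x y z => by simp) (fun c x y => by simp)
  have hf : ∀ x y, f x y = l ⁅s x, s y⁆ := fun x y => rfl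
  have hflie : ∀ x y z, f ⁅x, y⁆ z = f x ⁅y, z⁆ - f y ⁅x, z⁆ := fun x y z => by
    have h1 : ⁅s ⁅x, y⁆, s z⁆ = ⁅⁅s x, s y⁆, s z⁆ := hcong _ _ _ (by simp [hs'])
    have h2 : ⁅s x, s ⁅y, z⁆⁆ = ⁅s x, ⁅s y, s z⁆⁆ := hcong' _ _ _ (by simp [hs'])
    have h3 : ⁅s y, s ⁅x, z⁆⁆ = ⁅s y, ⁅s x, s z⁆⁆ := hcong' _ _ _ (by simp [hs'])
    rw [hf, hf, hf, h1, h2, h3, lie_lie, map_sub]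
  have hκ := LieAlgebra.IsKilling.killingForm_nondegenerate F S
  let κ : LinearMap.BilinForm F S := killingForm F S
  let δ : S →ₗ[F] S := (LinearMap.BilinForm.toDual κ hκ).symm.toLinearMap ∘ₗ f
  have hδ : ∀ x y, κ (δ x) y = f x y := fun x y =>
    LinearMap.BilinForm.apply_toDual_symm_apply (hB := hκ) _ _
  have hinv : ∀ x y z, κ ⁅x, y⁆ z = κ x ⁅y, z⁆ := LieModule.traceForm_apply_lie_apply F S S
  let D : LieDerivation F S S :=
    { toLinearMap := δ
      leibniz' := fun x y => by
        rw [← sub_eq_zero]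
        refine hκ.1 _ fun z => ?_
        change κ (δ ⁅x, y⁆ - (⁅x, δ y⁆ - ⁅y, δ x⁆)) z = 0
        rw [← lie_skew x (δ y), ← lie_skew y (δ x)]
        simp only [map_sub, map_neg, LinearMap.sub_apply, LinearMap.neg_apply, hinv, hδ, hflie]
        ring }
  obtain ⟨a, ha⟩ := LieDerivation.IsKilling.exists_eq_ad D
  have hD : ∀ x, δ x = ⁅a, x⁆ := fun x => by
    have h := LinearMap.congr_fun (LieDerivation.coe_ad_apply_eq_ad_apply (R := F) a) x
    rw [ha] at h
    exact h
  have key : ∀ u ∈ ⁅(⊤ : LieIdeal F K), (⊤ : LieIdeal F K)⁆, l u = κ a (π u) := by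
    intro u hu
    rw [← LieSubmodule.mem_toSubmodule, LieSubmodule.lieIdeal_oper_eq_linear_span'] at hu
    induction hu using Submodule.span_induction with
    | mem u hu =>
      obtain ⟨x, -, y, -, rfl⟩ := hu
      have h1 : ⁅x, y⁆ = ⁅s (π x), s (π y)⁆ := by
        rw [hcong x (s (π x)) y (hs' _).symm, hcong' y (s (π y)) _ (hs' _).symm]
      rw [h1, ← hf, ← hδ, hD, hinv, LieHom.map_lie, hs', hs']
    | zero => simp
    | add x y _ _ hx hy => rw [map_add, map_add, map_add, hx, hy]
    | smul c x _ hx => rw [map_smul, map_smul, map_smul, hx]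
  rw [key w hw, hw0, map_zero]

/-- The preimage of an abelian ideal has its derived ideal in the central Z, so it is solvable and
lies in rad(K) ⊆ Z. -/
theorem hasTrivialRadical_quotient_of_central [FiniteDimensional F K] (Z : LieIdeal F K)
    (hZ : ∀ z ∈ Z, ∀ c : K, ⁅c, z⁆ = 0) (hrad : LieAlgebra.radical F K ≤ Z) :
    LieAlgebra.HasTrivialRadical F (K ⧸ Z) := by
  rw [LieAlgebra.hasTrivialRadical_iff_no_abelian_ideals]
  intro J hJ
  let π : K →ₗ⁅F⁆ (K ⧸ Z) := { (LieSubmodule.Quotient.mk' Z : K →ₗ[F] K ⧸ Z) with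
    map_lie' := rfl }
  have hπ : ∀ x, π x = 0 → x ∈ Z := fun x => (LieSubmodule.Quotient.mk_eq_zero Z).1
  have hπs : Function.Surjective π := LieSubmodule.Quotient.surjective_mk' Z
  let I : LieIdeal F K := LieIdeal.comap π J
  have h2 : LieAlgebra.derivedSeriesOfIdeal F K 2 I = ⊥ := by
    have h1 : LieAlgebra.derivedSeriesOfIdeal F K 1 I ≤ Z := by
      rw [LieAlgebra.derivedSeriesOfIdeal_succ, LieAlgebra.derivedSeriesOfIdeal_zero,
        LieSubmodule.lie_le_iff]
      intro x hx y hy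
      refine hπ _ ?_
      rw [LieHom.map_lie]
      exact congrArg Subtype.val (hJ.trivial ⟨π x, hx⟩ ⟨π y, hy⟩)
    rw [LieAlgebra.derivedSeriesOfIdeal_succ, LieSubmodule.lie_eq_bot_iff]
    exact fun x _ y hy => hZ y (h1 hy) x
  have hs : LieAlgebra.IsSolvable I :=
    LieAlgebra.IsSolvable.mk (R := F) ((LieIdeal.derivedSeries_eq_bot_iff _ _).2 h2)
  have hle := ((LieAlgebra.LieIdeal.solvable_iff_le_radical F K I).1 hs).trans hrad
  rw [LieSubmodule.eq_bot_iff]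
  intro j hj
  obtain ⟨x, rfl⟩ := hπs j
  exact (LieSubmodule.Quotient.mk_eq_zero Z).2 (hle hj)

theorem isCompl_lie_top_top_of_central [CharZero F] [FiniteDimensional F K] (Z : LieIdeal F K)
    (hZ : ∀ z ∈ Z, ∀ c : K, ⁅c, z⁆ = 0) (hrad : LieAlgebra.radical F K ≤ Z) :
    IsCompl Z ⁅(⊤ : LieIdeal F K), (⊤ : LieIdeal F K)⁆ := by
  have := hasTrivialRadical_quotient_of_central Z hZ hrad
  have : FiniteDimensional F (K ⧸ Z) :=
    inferInstanceAs (FiniteDimensional F (K ⧸ Z.toSubmodule))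
  have : LieAlgebra.IsKilling F (K ⧸ Z) := inferInstance
  let π : K →ₗ⁅F⁆ (K ⧸ Z) := { (LieSubmodule.Quotient.mk' Z : K →ₗ[F] K ⧸ Z) with
    map_lie' := rfl }
  have hπ : ∀ x, π x = 0 ↔ x ∈ Z := fun x => LieSubmodule.Quotient.mk_eq_zero Z
  have hπs : Function.Surjective π := LieSubmodule.Quotient.surjective_mk' Z
  refine ⟨disjoint_iff_inf_le.2 fun w hw => ?_, codisjoint_iff_le_sup.2 fun x _ => ?_⟩
  · refine eq_zero_of_mem_lie_top_top_of_central π hπs (fun c hc d => ?_) hw.2 ((hπ w).2 hw.1)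
    rw [← lie_skew, hZ c ((hπ c).1 hc) d, neg_zero]
  -- The quotient is perfect, so [K, K] maps onto it and Z + [K, K] = K.
  · have h1 : LieIdeal.map π ⁅(⊤ : LieIdeal F K), (⊤ : LieIdeal F K)⁆ = ⊤ := by
      rw [LieIdeal.map_bracket_eq π hπs, ← LieHom.idealRange_eq_map,
        LieHom.idealRange_eq_top_of_surjective _ hπs, lie_top_top_eq_top_of_isKilling]
    obtain ⟨y, hy⟩ := LieIdeal.mem_map_of_surjective hπs 
      (show π x ∈ LieIdeal.map π ⁅(⊤ : LieIdeal F K), (⊤ : LieIdeal F K)⁆ by rw [h1]; trivial)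
    refine (LieSubmodule.mem_sup _ _ _).2 ⟨x - y, (hπ _).1 ?_, y, y.2, sub_add_cancel _ _⟩
    rw [map_sub, hy, sub_self]

end CharZero

/-! ### Decompositions of C -/

section Decomposition

variable {F L : Type*} [Field F] [LieRing L] [LieAlgebra F L]

theorem lie_eq_zero_of_mem_centralizer_of_mem_centerOf {N : LieIdeal F L} :
    ∀ c ∈ centralizer N, ∀ z ∈ centerOf N, ⁅c, z⁆ = 0 := fun _ hc _ hz => hc _ hz.1

theorem exists_semisimple_subalgebra_complement [FiniteDimensional F L] {C Z : LieIdeal F L}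
    (hZC : Z ≤ C) (hZ : ∀ c ∈ C, ∀ z ∈ Z, ⁅c, z⁆ = 0)
    (hrad : ∀ x ∈ LieAlgebra.radical F C, (x : L) ∈ Z)
    (hfr : frattiniOf C ⊓ Z.toSubmodule = ⊥) :
    ∃ B : LieSubalgebra F L,
      IsVectorDirectSum C.toSubmodule Z.toSubmodule B.toSubmodule ∧
      LieAlgebra.HasTrivialRadical F B ∧ ∃ J : LieIdeal F L, J.toSubmodule = square B := by
  obtain ⟨U, hU1, hU2⟩ := exists_isCompl_of_frattiniIdeal_disjoint (LieIdeal.comap C.incl Z)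
    (fun x _ y hy => Subtype.ext (hZ x x.2 y hy))
    (fun x hx hxZ => Subtype.ext ((Submodule.eq_bot_iff _).1 hfr x ⟨⟨x, hx, rfl⟩, hxZ⟩))
  let B : LieSubalgebra F L := U.map C.incl
  have hB : ∀ b ∈ B, ∃ u ∈ U, (u : L) = b := fun b hb => hb
  have hBC : ∀ b ∈ B, b ∈ C := fun b hb => by
    obtain ⟨u, -, rfl⟩ := hB b hb
    exact u.2
  have hdisj : ∀ b ∈ B, b ∈ Z → b = 0 := fun b hb hbZ => by
    obtain ⟨u, hu, rfl⟩ := hB b hb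
    exact congrArg Subtype.val ((Submodule.eq_bot_iff _).1 hU1 u ⟨hbZ, hu⟩)
  have hsup : ∀ c ∈ C, ∃ z ∈ Z, ∃ b ∈ B, z + b = c := fun c hc => by
    obtain ⟨z, hz, u, hu, h⟩ := Submodule.mem_sup.1
      (hU2.symm ▸ Submodule.mem_top : (⟨c, hc⟩ : C) ∈ _)
    exact ⟨z, hz, u, ⟨u, hu, rfl⟩, congrArg Subtype.val h⟩
  refine ⟨B, ⟨(Submodule.eq_bot_iff _).2 fun x hx => hdisj x hx.2 hx.1, le_antisymm
    (sup_le hZC hBC) fun c hc => ?_⟩, ?_, ⁅C, C⁆, ?_⟩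
  · obtain ⟨z, hz, b, hb, rfl⟩ := hsup c hc
    exact Submodule.add_mem_sup hz hb
  · refine hasTrivialRadical_of_complement hZC hZ hrad B.incl (fun b => hBC b b.2)
      (fun b hb => Subtype.ext (hdisj b b.2 hb)) fun c hc => ?_
    obtain ⟨z, hz, b, hb, h⟩ := hsup c hc
    exact ⟨z, hz, ⟨b, hb⟩, h⟩
  -- Since Z is central in C = Z + B, brackets ignore Z-components: [B, B] = [C, C], an ideal of L.
  · rw [LieSubmodule.lieIdeal_oper_eq_linear_span', square]
    refine congrArg _ (Set.ext fun w => ⟨?_, ?_⟩)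
    · rintro ⟨x, hx, y, hy, rfl⟩
      obtain ⟨z, hz, b, hb, rfl⟩ := hsup x hx
      obtain ⟨z', hz', b', hb', rfl⟩ := hsup y hy
      refine ⟨b, hb, b', hb', ?_⟩
      rw [lie_add, hZ _ hx z' hz', zero_add, add_lie, ← lie_skew z b', hZ _ (hBC _ hb') z hz,
        neg_zero, zero_add]
    · rintro ⟨x, hx, y, hy, rfl⟩
      exact ⟨x, hBC x hx, y, hBC y hy, rfl⟩

theorem exists_semisimple_ideal_complement [FiniteDimensional F L] {C Z : LieIdeal F L}
    (hZC : Z ≤ C) (hZ : ∀ c ∈ C, ∀ z ∈ Z, ⁅c, z⁆ = 0)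
    (hrad : ∀ x ∈ LieAlgebra.radical F C, (x : L) ∈ Z)
    (hfr : frattiniIdeal F L ⊓ Z = ⊥) :
    ∃ B : LieIdeal F L, IsAlgebraDirectSum C Z B ∧ IsSemisimpleIdeal B := by
  obtain ⟨U, hU1, hU2⟩ := exists_isCompl_of_frattiniIdeal_disjoint Z
    (fun x hx y hy => hZ x (hZC hx) y hy)
    (fun x hx hxZ => (LieSubmodule.eq_bot_iff _).1 hfr x ⟨hx, hxZ⟩)
  have hsup : ∀ x : L, ∃ z ∈ Z, ∃ u ∈ U, z + u = x := fun x =>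
    Submodule.mem_sup.1 (hU2.symm ▸ Submodule.mem_top : x ∈ _)
  have hZ' : ∀ z ∈ Z, ∀ c ∈ C, ⁅z, c⁆ = 0 := fun z hz c hc => by
    rw [← lie_skew, hZ c hc z hz, neg_zero]
  let B : LieIdeal F L :=
    { toSubmodule := C.toSubmodule ⊓ U.toSubmodule
      lie_mem := by
        rintro x b ⟨hbC, hbU⟩
        refine ⟨lie_mem_right F L C _ _ hbC, ?_⟩
        -- Z kills C, so only the U-component of x acts on b.
        obtain ⟨z, hz, u, hu, rfl⟩ := hsup x
        rw [add_lie, hZ' z hz b hbC, zero_add]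
        exact U.lie_mem hu hbU }
  have hdisj : ∀ b ∈ B, b ∈ Z → b = 0 := fun b hb hbZ =>
    (Submodule.eq_bot_iff _).1 hU1 b ⟨hbZ, hb.2⟩
  have hsupB : ∀ c ∈ C, ∃ z ∈ Z, ∃ b ∈ B, z + b = c := fun c hc => by
    obtain ⟨z, hz, u, hu, rfl⟩ := hsup c
    refine ⟨z, hz, u, ⟨?_, hu⟩, rfl⟩
    have := sub_mem hc (hZC hz)
    rwa [add_sub_cancel_left] at this
  refine ⟨B, ⟨⟨(Submodule.eq_bot_iff _).2 fun x hx => hdisj x hx.2 hx.1, le_antisymm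
    (sup_le hZC fun b hb => hb.1) fun c hc => ?_⟩, fun z hz b hb => hZ' z hz b hb.1⟩, ?_⟩
  · obtain ⟨z, hz, b, hb, rfl⟩ := hsupB c hc
    exact Submodule.add_mem_sup hz hb
  · refine hasTrivialRadical_of_complement hZC hZ hrad B.incl (fun b => b.2.1)
      (fun b hb => Subtype.ext (hdisj b b.2 hb)) fun c hc => ?_
    obtain ⟨z, hz, b, hb, h⟩ := hsupB c hc
    exact ⟨z, hz, ⟨b, hb⟩, h⟩

/-- A semisimple S ⊇ B lies in C = Z(N) + B; the Z(N)-component of an element of S lies in S ∩ N =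
0. -/
theorem maximal_isSemisimpleIdeal_of_isAlgebraDirectSum [FiniteDimensional F L] {B : LieIdeal F L}
    (hB : IsAlgebraDirectSum (centralizer (nilradical F L)) (centerOf (nilradical F L)) B)
    (hss : IsSemisimpleIdeal B) : Maximal IsSemisimpleIdeal B := by
  refine ⟨hss, fun S hS hBS s hs => ?_⟩
  have hsC : s ∈ (centralizer (nilradical F L)).toSubmodule := hS.le_centralizer_nilradical hs
  rw [← hB.1.2] at hsC
  obtain ⟨z, hz, b, hb, rfl⟩ := Submodule.mem_sup.1 hsC
  have hzS : z ∈ S := by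
    have := sub_mem hs (hBS hb)
    rwa [add_sub_cancel_right] at this
  rw [hS.inf_nilradical_eq_zero hzS hz.1, zero_add]
  exact hb

theorem IsSemisimpleIdeal.le_lie_self_of_le [CharZero F] [FiniteDimensional F L]
    {S C : LieIdeal F L} (hS : IsSemisimpleIdeal S) (hSC : S ≤ C) : S ≤ ⁅C, C⁆ := by
  have : LieAlgebra.HasTrivialRadical F S := hS
  have hperf : ⁅(⊤ : LieIdeal F S), (⊤ : LieIdeal F S)⁆ = ⊤ := lie_top_top_eq_top_of_isKilling
  intro x hx
  rw [← LieIdeal.comap_incl_self S, LieIdeal.comap_bracket_incl_of_le (I := S) le_rfl le_rfl]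
    at hperf
  have : (⟨x, hx⟩ : S) ∈ LieIdeal.comap S.incl ⁅S, S⁆ := by
    rw [hperf]; exact hx
  exact LieSubmodule.mono_lie hSC hSC (LieIdeal.mem_comap.1 this)

theorem isAlgebraDirectSum_lie_self [CharZero F] [FiniteDimensional F L] {C Z : LieIdeal F L}
    (hZC : Z ≤ C) (hZ : ∀ c ∈ C, ∀ z ∈ Z, ⁅c, z⁆ = 0)
    (hrad : ∀ x ∈ LieAlgebra.radical F C, (x : L) ∈ Z) :
    IsAlgebraDirectSum C Z ⁅C, C⁆ ∧ IsSemisimpleIdeal ⁅C, C⁆ := by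
  have hcompl := isCompl_lie_top_top_of_central (LieIdeal.comap C.incl Z)
    (fun z hz c => Subtype.ext (hZ c c.2 z hz)) (fun x hx => hrad x hx)
  rw [← LieIdeal.comap_incl_self C, LieIdeal.comap_bracket_incl_of_le (I := C) le_rfl le_rfl]
    at hcompl
  have hCC : ⁅C, C⁆ ≤ C := LieSubmodule.lie_le_left _ _
  have hdisj : ∀ b ∈ ⁅C, C⁆, b ∈ Z → b = 0 := fun b hb hbZ => by
    have h : (⟨b, hZC hbZ⟩ : C) ∈ LieIdeal.comap C.incl Z ⊓ LieIdeal.comap C.incl ⁅C, C⁆ :=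
      ⟨hbZ, hb⟩
    rw [hcompl.inf_eq_bot] at h
    exact congrArg Subtype.val h
  have hsup : ∀ c ∈ C, ∃ z ∈ Z, ∃ b ∈ ⁅C, C⁆, z + b = c := fun c hc => by
    have h : (⟨c, hc⟩ : C) ∈ LieIdeal.comap C.incl Z ⊔ LieIdeal.comap C.incl ⁅C, C⁆ := by
      rw [hcompl.sup_eq_top]; trivial
    obtain ⟨z, hz, b, hb, h⟩ := (LieSubmodule.mem_sup _ _ _).1 h
    exact ⟨z, hz, b, hb, congrArg Subtype.val h⟩
  refine ⟨⟨⟨(Submodule.eq_bot_iff _).2 fun x hx => hdisj x hx.2 hx.1, le_antisymm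
    (sup_le hZC hCC) fun c hc => ?_⟩, fun z hz b hb => ?_⟩, ?_⟩
  · obtain ⟨z, hz, b, hb, rfl⟩ := hsup c hc
    exact Submodule.add_mem_sup hz hb
  · rw [← lie_skew, hZ b (hCC hb) z hz, neg_zero]
  · refine hasTrivialRadical_of_complement hZC hZ hrad (LieIdeal.incl ⁅C, C⁆) (fun b => hCC b.2)
      (fun b hb => Subtype.ext (hdisj b b.2 hb)) fun c hc => ?_
    obtain ⟨z, hz, b, hb, h⟩ := hsup c hc
    exact ⟨z, hz, ⟨b, hb⟩, h⟩

end Decomposition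

end LieNilrad

theorem corollaryc {F L : Type*} [Field F] [LieRing L] [LieAlgebra F L] [FiniteDimensional F L]
    (N Z C : LieIdeal F L)
    (hN : N = LieNilrad.nilradical F L)
    (hZ : Z = LieNilrad.centerOf N)
    (hC : C = LieNilrad.centralizer N)
    (hreg : LieNilrad.IsRegular F C) :
    (LieNilrad.frattiniOf C ⊓ Z.toSubmodule = ⊥ →
      ∃ B : LieSubalgebra F L,
        LieNilrad.IsVectorDirectSum C.toSubmodule Z.toSubmodule B.toSubmodule ∧
        LieAlgebra.HasTrivialRadical F B ∧
        ∃ J : LieIdeal F L, J.toSubmodule = LieNilrad.square B) ∧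
    (LieNilrad.frattiniIdeal F L ⊓ Z = ⊥ →
      ∃ B : LieIdeal F L,
        LieNilrad.IsAlgebraDirectSum C Z B ∧
        Maximal LieNilrad.IsSemisimpleIdeal B) ∧
    (CharZero F →
      ∃ S : LieIdeal F L,
        LieNilrad.IsAlgebraDirectSum C Z S ∧
        IsGreatest {I : LieIdeal F L | LieNilrad.IsSemisimpleIdeal I} S) := by
  subst hN hZ hC
  have hZC : LieNilrad.centerOf (LieNilrad.nilradical F L) ≤
      LieNilrad.centralizer (LieNilrad.nilradical F L) := inf_le_right
  have hrad : ∀ x ∈ LieAlgebra.radical F (LieNilrad.centralizer (LieNilrad.nilradical F L)),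
      (x : L) ∈ LieNilrad.centerOf (LieNilrad.nilradical F L) := fun x hx =>
    ⟨LieNilrad.mem_nilradical_of_mem_radical_centralizer hreg x hx, x.2⟩
  have hcen := LieNilrad.lie_eq_zero_of_mem_centralizer_of_mem_centerOf
    (N := LieNilrad.nilradical F L)
  refine ⟨LieNilrad.exists_semisimple_subalgebra_complement hZC hcen hrad, fun hfr => ?_,
    fun _ => ?_⟩
  · obtain ⟨B, hB, hss⟩ := LieNilrad.exists_semisimple_ideal_complement hZC hcen hrad hfr
    exact ⟨B, hB, LieNilrad.maximal_isSemisimpleIdeal_of_isAlgebraDirectSum hB hss⟩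
  · obtain ⟨hS, hss⟩ := LieNilrad.isAlgebraDirectSum_lie_self hZC hcen hrad
    exact ⟨_, hS, hss, fun I hI =>
      LieNilrad.IsSemisimpleIdeal.le_lie_self_of_le hI hI.le_centralizer_nilradical⟩
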